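/- Let $p$ be a probability mass function on $\mathbb N_0$ with finite support, let $m$ and $M$ be the smallest and the largest point of its support (for instance, the support is $\{m,\dots,M\}$), and let $k\ge 1$ be an integer with $m\le M-k$. For a real sequence $f$ on $\mathbb N_0$ put $\Delta f(j)=f(j+1)-f(j)$ and $\nabla^k f(j)=(-1)^k\Delta^k f(j)$, where $\Delta^k$ is the $k$-fold iterate of $\Delta$. Let $\mathcal S_k=\{m,\dots,M-k\}$, $\rho_k=\min_{j\in\mathcal S_k}\nabla^k p(j)$ and $I=\{i\in\mathcal S_k:\nabla^k p(i)=\rho_k\}$. Let $X_1,X_2,\dots$ be independent random variables with distribution $p$. For $n\ge1$ let $\widehat p_n(j)=n^{-1}\sum_{i=1}^n\mathbf 1_{\{X_i=j\}}$, $X_{(1)}=\min_{i\le n}X_i$, $X_{(n)}=\max_{i\le n}X_i$, and $$\widehat\rho_{k,n}=\min\{\nabla^k\widehat p_n(j): X_{(1)}\le j\le X_{(n)}-k\},$$ set equal to $0$ if there is no such $j$ (an event whose probability tends to $0$). Let $(Z_j)_{j\in\mathcal S_k}$ be a random vector with distribution $\mathcal N(0,\Sigma)$, where $\Sigma_{r,s}=\operatorname{Cov}\bigl[\nabla^k\mathbf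 1_{\{X_1=r\}},\nabla^k\mathbf 1_{\{X_1=s\}}\bigr]$ for $r,s\in\mathcal S_k$; here $\nabla^k\mathbf 1_{\{X_1=r\}}$ denotes $\nabla^k$ of the sequence $j\mapsto\mathbf 1_{\{X_1=j\}}$, evaluated at $j=r$. ($I$ is nonempty, and $\Sigma$ is positive semidefinite.) Then, as $n\to\infty$, $\sqrt n\,(\widehat\rho_{k,n}-\rho_k)$ converges in distribution to $\min_{j\in I}Z_j$. In particular, if $\rho_k=0$, then $I=\mathcal S_k\setminus J$, where $J=\{j\in\mathcal S_k:\nabla^k p(j)>0\}$ is the set of knots of $p$. -/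

import Mathlib

open MeasureTheory ProbabilityTheory Filter

namespace KMono

/-- The signed `k`-th difference `∇^k f(j) = (-1)^k Δ^k f(j)`, where `Δ f(j) = f(j+1) - f(j)` and
`Δ^k` is the `k`-fold iterate of `Δ`. -/
noncomputable def nabla (k : ℕ) (f : ℕ → ℝ) (j : ℕ) : ℝ :=
  (-1 : ℝ) ^ k * (fwdDiff (1 : ℕ))^[k] f j

/-- The integer interval `{a, …, b - k}` (subtraction in the integers: the set of all `j ≥ a`
with `j + k ≤ b`, which is empty when `b < a + k`). -/
def shrink (k a b : ℕ) : Finset ℕ :=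
  (Finset.Icc a b).filter fun j => j + k ≤ b

/-- The minimum of `f` over the finite set `s`; by convention `0` if `s` is empty. -/
noncomputable def minOver (s : Finset ℕ) (f : ℕ → ℝ) : ℝ :=
  if h : s.Nonempty then s.inf' h f else 0

/-- The probability mass function `p` as a real-valued sequence. -/
noncomputable def mass (p : PMF ℕ) (j : ℕ) : ℝ := (p j).toReal

/-- `ρ_k = min_{j ∈ {m, …, M-k}} ∇^k p(j)`. -/
noncomputable def rho (p : PMF ℕ) (k m M : ℕ) : ℝ :=
  minOver (shrink k m M) (nabla k (mass p))

/-- The set `I` of the indices `i ∈ {m, …, M-k}` with `∇^k p(i) = ρ_k`. -/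
noncomputable def argminSet (p : PMF ℕ) (k m M : ℕ) : Finset ℕ :=
  open Classical in (shrink k m M).filter fun i => nabla k (mass p) i = rho p k m M

/-- The set `J` of the knots of `p`: the indices `j ∈ {m, …, M-k}` with `∇^k p(j) > 0`. -/
noncomputable def knots (p : PMF ℕ) (k m M : ℕ) : Finset ℕ :=
  open Classical in (shrink k m M).filter fun j => 0 < nabla k (mass p) j

/-- The indicator `1_{x = j}`, as a function of `j`. -/
def ind (x j : ℕ) : ℝ := if x = j then 1 else 0

/-- The empirical probability mass function of the sample `x`. -/
noncomputable def empMass {n : ℕ} (x : Fin n → ℕ) (j : ℕ) : ℝ :=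
  (n : ℝ)⁻¹ * ∑ i, ind (x i) j

/-- The smallest observation of the sample `x`, for `n ≥ 1`. -/
noncomputable def sampleMin {n : ℕ} (x : Fin n → ℕ) : ℕ := ⨅ i, x i

/-- The largest observation of the sample `x`, for `n ≥ 1`. -/
noncomputable def sampleMax {n : ℕ} (x : Fin n → ℕ) : ℕ := ⨆ i, x i

/-- The estimator `ρ̂_{k,n}`: the minimum of `∇^k p̂_n` over `{X_(1), …, X_(n) - k}`. -/
noncomputable def rhoHat (k : ℕ) {n : ℕ} (x : Fin n → ℕ) : ℝ :=
  minOver (shrink k (sampleMin x) (sampleMax x)) (nabla k (empMass x))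

/-- The matrix `Σ`, with rows and columns indexed by `{m, …, M-k}`, of the covariances of the
variables `∇^k 1_{Y = ·}(r)`, for a random variable `Y`. -/
noncomputable def covMat {Ω : Type*} [MeasurableSpace Ω] (P : Measure Ω) (Y : Ω → ℕ)
    (k m M : ℕ) : Matrix (shrink k m M) (shrink k m M) ℝ :=
  Matrix.of fun r s => cov[fun ω => nabla k (ind (Y ω)) r, fun ω => nabla k (ind (Y ω)) s; P]

end KMono

/-! Almost surely the sample stays in `[m, M]`, eventually attains both endpoints, and its empirical
masses converge to `p` by the strong law. The finitely many strict gaps between `rho` and the values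
of `nabla k (mass p)` off `argminSet` then persist, so eventually `rhoHat` is a minimum over
`argminSet` alone (`eventually_rhoHat_eq`). There every centring equals `rho`, so the rescaled error
is exactly the minimum of the rescaled differences. These are jointly asymptotically Gaussian
(`tendstoInDistribution_nabla_empMass`), and the minimum is continuous; an almost surely vanishing
remainder does not change the limit law. -/

namespace KMono

/-! ### Multivariate central limit theorem via characteristic functions. -/

section CentralLimit

open Topology
open scoped RealInnerProductSpace

variable {Ω : Type*} [MeasurableSpace Ω] {P : Measure Ω} [IsProbabilityMeasure P]
  {ι : Type*} [Fintype ι]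

/-- The matrix of covariances of finitely many square integrable variables, as a quadratic form,
is the variance of the linear combination. -/
lemma dotProduct_covMatrix_mulVec {Y : ι → Ω → ℝ} (hY : ∀ i, MemLp (Y i) 2 P) (t : ι → ℝ) :
    t ⬝ᵥ (Matrix.of fun r s => cov[Y r, Y s; P]).mulVec t = Var[fun ω => ∑ i, t i * Y i ω; P] := by
  have hL : ∀ i, MemLp (fun ω => t i * Y i ω) 2 P := fun i => (hY i).const_mul _
  rw [← covariance_self (memLp_finsetSum _ fun i _ => hL i).aestronglyMeasurable.aemeasurable,
    covariance_fun_sum_fun_sum hL hL]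
  simp only [dotProduct, Matrix.mulVec, Matrix.of_apply, covariance_const_mul_left,
    covariance_const_mul_right, Finset.mul_sum]
  exact Finset.sum_congr rfl fun i _ => Finset.sum_congr rfl fun j _ => by ring

lemma posSemidef_covMatrix {Y : ι → Ω → ℝ} (hY : ∀ i, MemLp (Y i) 2 P) :
    (Matrix.of fun r s => cov[Y r, Y s; P]).PosSemidef := by
  refine Matrix.PosSemidef.of_dotProduct_mulVec_nonneg ?_ fun t => ?_
  · ext r s
    simp [covariance_comm]
  · rw [star_trivial, dotProduct_covMatrix_mulVec hY]
    exact variance_nonneg _ _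

/-- **Multivariate central limit theorem** in `EuclideanSpace ℝ ι`. -/
theorem tendstoInDistribution_multivariate [DecidableEq ι]
    {Ω' : Type*} [MeasurableSpace Ω'] {P' : Measure Ω'} [IsProbabilityMeasure P']
    {Y : ℕ → Ω → EuclideanSpace ℝ ι} {Z : Ω' → EuclideanSpace ℝ ι}
    (hY : ∀ i, MemLp (fun ω => Y 0 ω i) 2 P) (hindep : iIndepFun Y P)
    (hident : ∀ n, IdentDistrib (Y n) (Y 0) P P)
    (hZ : HasLaw Z
      (multivariateGaussian 0 (Matrix.of fun r s => cov[fun ω => Y 0 ω r, fun ω => Y 0 ω s; P])) P') :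
    TendstoInDistribution
      (fun (n : ℕ) ω => WithLp.toLp 2 fun i =>
        (√(n : ℝ))⁻¹ * (∑ k ∈ Finset.range n, Y k ω i - n * ∫ ω', Y 0 ω' i ∂P))
      atTop Z (fun _ => P) P' := by
  have mY n : AEMeasurable (Y n) P := (hident n).aemeasurable_fst
  have mV (n : ℕ) : AEMeasurable (fun ω => WithLp.toLp 2 fun i =>
      (√(n : ℝ))⁻¹ * (∑ k ∈ Finset.range n, Y k ω i - n * ∫ ω', Y 0 ω' i ∂P)) P := by
    refine (WithLp.measurable_toLp 2 _).comp_aemeasurable (aemeasurable_pi_lambda _ fun i => ?_)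
    refine .const_mul (.sub_const (Finset.aemeasurable_fun_sum _ fun k _ => ?_) _) _
    exact (EuclideanSpace.proj (𝕜 := ℝ) i).continuous.measurable.comp_aemeasurable (mY k)
  refine ⟨mV, hZ.aemeasurable, ProbabilityMeasure.tendsto_iff_tendsto_charFun.2 fun t => ?_⟩
  -- Cramér–Wold: the characteristic function of a vector at `t` is that of its projection along `t`
  -- at `1`, so the real central limit theorem suffices.
  let g : EuclideanSpace ℝ ι → ℝ := fun x => ∑ i, t i * x i
  have hg : Measurable g := by fun_prop
  have hsum : MemLp (fun ω => g (Y 0 ω)) 2 P := memLp_finsetSum _ fun i _ => (hY i).const_mul _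
  have hclt := tendstoInDistribution_inv_sqrt_mul_sum_sub (P := P)
    (P' := gaussianReal 0 Var[fun ω => g (Y 0 ω); P].toNNReal) (Y := id)
    (X := fun n ω => g (Y n ω)) HasLaw.id hsum (hindep.comp (fun _ => g) fun _ => hg)
    fun n => (hident n).comp hg
  have hch := ProbabilityMeasure.tendsto_iff_tendsto_charFun.1 hclt.tendsto 1
  have hlim : charFun (P'.map Z) t =
      charFun ((gaussianReal 0 Var[fun ω => g (Y 0 ω); P].toNNReal).map id) 1 := by
    rw [hZ.map_eq, charFun_multivariateGaussian (posSemidef_covMatrix hY), Measure.map_id,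
      charFun_gaussianReal, dotProduct_covMatrix_mulVec hY,
      Real.coe_toNNReal _ (variance_nonneg _ _)]
    simp [g]
  simp only [ProbabilityMeasure.coe_mk] at hch ⊢
  rw [hlim]
  refine hch.congr fun n => ?_
  rw [charFun_apply, charFun_apply, integral_map (hclt.forall_aemeasurable n) (by fun_prop),
    integral_map (mV n) (by fun_prop)]
  congr 1
  ext ω
  congr 3
  have hint : ∫ ω', g (Y 0 ω') ∂P = ∑ i, t i * ∫ ω', Y 0 ω' i ∂P := by
    simp only [g]
    rw [integral_finsetSum _ fun i _ => ((hY i).integrable (by norm_num)).const_mul _]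
    simp [integral_const_mul]
  rw [hint]
  simp only [g, PiLp.inner_apply, RCLike.inner_apply, conj_trivial, one_mul]
  rw [Finset.sum_comm, Finset.mul_sum, ← Finset.sum_sub_distrib, Finset.mul_sum]
  refine Finset.sum_congr rfl fun i _ => ?_
  rw [← Finset.mul_sum]
  ring

end CentralLimit

/-! ### Finite differences, finite minima and the localisation to the argmin set. -/

section Deterministic

open Topology

/-- Only linearity and the finite window matter later, so the binomial coefficients stay hidden. -/
lemma exists_nabla_eq_sum (k : ℕ) :
    ∃ c : ℕ → ℝ, ∀ f j, nabla k f j = ∑ i ∈ Finset.range (k + 1), c i * f (j + i) := by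
  refine ⟨fun i => (-1) ^ k * ((-1) ^ (k - i) * (k.choose i : ℝ)), fun f j => ?_⟩
  rw [nabla, fwdDiff_iter_eq_sum_shift, Finset.mul_sum]
  refine Finset.sum_congr rfl fun i _ => ?_
  simp only [smul_eq_mul, mul_one, zsmul_eq_mul]
  push_cast
  ring

lemma nabla_empMass (k : ℕ) {n : ℕ} (x : Fin n → ℕ) (j : ℕ) :
    nabla k (empMass x) j = (n : ℝ)⁻¹ * ∑ i, nabla k (ind (x i)) j := by
  obtain ⟨c, hc⟩ := exists_nabla_eq_sum k
  simp only [hc, empMass]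
  rw [Finset.sum_comm, Finset.mul_sum]
  refine Finset.sum_congr rfl fun i _ => ?_
  rw [← Finset.mul_sum]
  ring

lemma tendsto_nabla {ι : Type*} {l : Filter ι} {f : ι → ℕ → ℝ} {g : ℕ → ℝ}
    (h : ∀ j, Tendsto (fun n => f n j) l (𝓝 (g j))) (k j : ℕ) :
    Tendsto (fun n => nabla k (f n) j) l (𝓝 (nabla k g j)) := by
  obtain ⟨c, hc⟩ := exists_nabla_eq_sum k
  simp only [hc]
  exact tendsto_finsetSum _ fun i _ => (h _).const_mul _

lemma mem_shrink {k a b j : ℕ} : j ∈ shrink k a b ↔ a ≤ j ∧ j + k ≤ b := by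
  simp only [shrink, Finset.mem_filter, Finset.mem_Icc]
  omega

lemma minOver_le {s : Finset ℕ} {i : ℕ} (hi : i ∈ s) (f : ℕ → ℝ) : minOver s f ≤ f i := by
  rw [minOver, dif_pos ⟨i, hi⟩]
  exact Finset.inf'_le _ hi

lemma exists_minOver_eq {s : Finset ℕ} (hs : s.Nonempty) (f : ℕ → ℝ) :
    ∃ i ∈ s, minOver s f = f i := by
  rw [minOver, dif_pos hs]
  exact Finset.exists_mem_eq_inf' hs f

lemma minOver_eq_iff {s : Finset ℕ} (hs : s.Nonempty) {f : ℕ → ℝ} {a : ℝ} :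
    minOver s f = a ↔ (∃ i ∈ s, f i = a) ∧ ∀ i ∈ s, a ≤ f i := by
  constructor
  · rintro rfl
    obtain ⟨i, hi, h⟩ := exists_minOver_eq hs f
    exact ⟨⟨i, hi, h.symm⟩, fun i hi => minOver_le hi f⟩
  · rintro ⟨⟨i, hi, rfl⟩, h⟩
    obtain ⟨j, hj, h'⟩ := exists_minOver_eq hs f
    exact le_antisymm (minOver_le hi f) (h' ▸ h j hj)

lemma mul_minOver_sub {s : Finset ℕ} (hs : s.Nonempty) {c : ℝ} (hc : 0 ≤ c) (f : ℕ → ℝ) (a : ℝ) :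
    c * (minOver s f - a) = minOver s fun j => c * (f j - a) := by
  obtain ⟨i, hi, h⟩ := exists_minOver_eq hs f
  refine ((minOver_eq_iff hs).2 ⟨⟨i, hi, by rw [h]⟩, fun j hj => ?_⟩).symm
  have := minOver_le hj f
  gcongr

lemma minOver_congr {s : Finset ℕ} {f g : ℕ → ℝ} (h : ∀ j ∈ s, f j = g j) :
    minOver s f = minOver s g := by
  unfold minOver
  split_ifs with hs
  · exact Finset.inf'_congr hs rfl h
  · rfl

lemma continuous_minOver {E : Type*} [TopologicalSpace E] (s : Finset ℕ) {f : E → ℕ → ℝ}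
    (hf : ∀ j ∈ s, Continuous fun x => f x j) : Continuous fun x => minOver s (f x) := by
  unfold minOver
  split_ifs with hs
  · exact Continuous.finset_inf'_apply hs hf
  · exact continuous_const

lemma minOver_subset {s t : Finset ℕ} (ht : t.Nonempty) (hts : t ⊆ s) {f : ℕ → ℝ}
    (h : ∀ i ∈ t, ∀ j ∈ s, j ∉ t → f i ≤ f j) : minOver s f = minOver t f := by
  obtain ⟨i, hi, hf⟩ := exists_minOver_eq ht f
  refine (minOver_eq_iff (ht.mono hts)).2 ⟨⟨i, hts hi, hf.symm⟩, fun j hj => ?_⟩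
  by_cases hjt : j ∈ t
  · exact minOver_le hjt f
  · exact hf ▸ h i hi j hj hjt

variable (p : PMF ℕ) (k m M : ℕ)

lemma mem_argminSet {i : ℕ} :
    i ∈ argminSet p k m M ↔ i ∈ shrink k m M ∧ nabla k (mass p) i = rho p k m M := by
  simp [argminSet]

lemma argminSet_subset : argminSet p k m M ⊆ shrink k m M := fun _ hi =>
  ((mem_argminSet p k m M).1 hi).1

variable {m M k}

lemma shrink_nonempty (hmM : m + k ≤ M) : (shrink k m M).Nonempty := ⟨m, mem_shrink.2 ⟨le_rfl, hmM⟩⟩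

lemma argminSet_nonempty (hmM : m + k ≤ M) : (argminSet p k m M).Nonempty := by
  obtain ⟨i, hi, h⟩ := exists_minOver_eq (shrink_nonempty hmM) (nabla k (mass p))
  exact ⟨i, (mem_argminSet p k m M).2 ⟨hi, h.symm⟩⟩

lemma argminSet_eq_sdiff_knots (h : rho p k m M = 0) :
    argminSet p k m M = shrink k m M \ knots p k m M := by
  ext i
  simp only [mem_argminSet, Finset.mem_sdiff, knots, Finset.mem_filter, h, not_and, not_lt]
  refine and_congr_right fun hi => ⟨fun h' _ => h'.le, fun h' => le_antisymm (h' hi) ?_⟩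
  exact h ▸ minOver_le hi (nabla k (mass p))

lemma sampleMin_eq {n : ℕ} {x : Fin n → ℕ} (h : ∀ i, m ≤ x i) (h' : ∃ i, x i = m) :
    sampleMin x = m := by
  obtain ⟨i, hi⟩ := h'
  have : Nonempty (Fin n) := ⟨i⟩
  exact le_antisymm ((ciInf_le (OrderBot.bddBelow _) i).trans hi.le) (le_ciInf h)

lemma sampleMax_eq {n : ℕ} {x : Fin n → ℕ} (h : ∀ i, x i ≤ M) (h' : ∃ i, x i = M) :
    sampleMax x = M := by
  obtain ⟨i, hi⟩ := h'
  have : Nonempty (Fin n) := ⟨i⟩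
  exact le_antisymm (ciSup_le h) (hi.symm.le.trans (le_ciSup (Set.finite_range x).bddAbove i))

lemma exists_eq_of_empMass_pos {n : ℕ} {x : Fin n → ℕ} {j : ℕ} (h : 0 < empMass x j) :
    ∃ i, x i = j := by
  by_contra! hx
  simp [empMass, ind, hx] at h

/-- Along any sequence of samples that stay in `[m, M]` and whose empirical mass functions converge
to `p`, the estimator is eventually the minimum over the argmin set only. -/
lemma eventually_rhoHat_eq {x : ℕ → ℕ} (hmM : m + k ≤ M)
    (hm : 0 < mass p m) (hM : 0 < mass p M) (hx : ∀ i, x i ∈ Set.Icc m M)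
    (hlim : ∀ j, Tendsto (fun n : ℕ => empMass (fun i : Fin n => x i) j) atTop (𝓝 (mass p j))) :
    ∀ᶠ n : ℕ in atTop, rhoHat k (fun i : Fin n => x i) =
      minOver (argminSet p k m M) (nabla k (empMass fun i : Fin n => x i)) := by
  have hev : ∀ᶠ n : ℕ in atTop, ∀ i ∈ argminSet p k m M, ∀ j ∈ shrink k m M \ argminSet p k m M,
      nabla k (empMass fun i : Fin n => x i) i < nabla k (empMass fun i : Fin n => x i) j := by
    rw [eventually_all_finset]
    intro i hi
    rw [eventually_all_finset]
    intro j hj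
    -- The limits differ strictly, since `j` is not a minimiser.
    refine (tendsto_nabla hlim k i).eventually_lt (tendsto_nabla hlim k j) ?_
    rw [Finset.mem_sdiff, mem_argminSet, not_and] at hj
    rw [((mem_argminSet p k m M).1 hi).2]
    exact (minOver_le hj.1 _).lt_of_ne fun h => hj.2 hj.1 h.symm
  filter_upwards [hev, (hlim m).eventually_const_lt hm, (hlim M).eventually_const_lt hM]
    with n hn hnm hnM
  rw [rhoHat, sampleMin_eq (fun i => (hx i).1) (exists_eq_of_empMass_pos hnm),
    sampleMax_eq (fun i => (hx i).2) (exists_eq_of_empMass_pos hnM)]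
  exact minOver_subset (argminSet_nonempty p hmM) (argminSet_subset p k m M) fun i hi j hj hj' =>
    (hn i hi j (Finset.mem_sdiff.2 ⟨hj, hj'⟩)).le

end Deterministic

/-! ### Moments and almost sure behaviour of the sample. -/

section Sample

open Topology

variable {Ω : Type*} [MeasurableSpace Ω] {P : Measure Ω} {p : PMF ℕ}

lemma memLp_ind [IsFiniteMeasure P] {Y : Ω → ℕ} (hY : AEMeasurable Y P) (q : ENNReal) (j : ℕ) :
    MemLp (fun ω => ind (Y ω) j) q P := by
  have hmeas : Measurable fun y => ind y j := measurable_of_countable _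
  refine MemLp.of_bound (hmeas.comp_aemeasurable hY).aestronglyMeasurable 1 (ae_of_all _ fun ω => ?_)
  unfold ind
  split_ifs <;> simp

lemma memLp_nabla_ind [IsFiniteMeasure P] {Y : Ω → ℕ} (hY : AEMeasurable Y P) (q : ENNReal) (k j : ℕ) :
    MemLp (fun ω => nabla k (ind (Y ω)) j) q P := by
  obtain ⟨c, hc⟩ := exists_nabla_eq_sum k
  simp only [hc]
  exact memLp_finsetSum _ fun i _ => (memLp_ind hY q _).const_mul _

lemma integral_ind {Y : Ω → ℕ} (hY : HasLaw Y p.toMeasure P) (j : ℕ) :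
    ∫ ω, ind (Y ω) j ∂P = mass p j := by
  have h : ∫ ω, ind (Y ω) j ∂P = ∫ y, ind y j ∂p.toMeasure :=
    hY.integral_comp (f := fun y => ind y j) (measurable_of_countable _).aestronglyMeasurable
  have h' : (fun y => ind y j) = Set.indicator {j} 1 := by
    ext y
    simp [ind, Set.indicator_apply]
  rw [h, h', integral_indicator_one (MeasurableSet.of_discrete), measureReal_def,
    PMF.toMeasure_apply_singleton _ _ MeasurableSet.of_discrete, mass]

lemma integral_nabla_ind [IsFiniteMeasure P] {Y : Ω → ℕ} (hY : HasLaw Y p.toMeasure P) (k j : ℕ) :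
    ∫ ω, nabla k (ind (Y ω)) j ∂P = nabla k (mass p) j := by
  obtain ⟨c, hc⟩ := exists_nabla_eq_sum k
  simp only [hc]
  rw [integral_finsetSum _ fun i _ =>
    ((memLp_ind hY.aemeasurable 1 _).integrable le_rfl).const_mul _]
  simp [integral_const_mul, integral_ind hY]

lemma ae_tendsto_empMass [IsProbabilityMeasure P] {X : ℕ → Ω → ℕ} (hlaw : ∀ i, HasLaw (X i) p.toMeasure P)
    (hindep : iIndepFun X P) :
    ∀ᵐ ω ∂P, ∀ j, Tendsto (fun n : ℕ => empMass (fun i : Fin n => X i ω) j) atTop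
      (𝓝 (mass p j)) := by
  refine ae_all_iff.2 fun j => ?_
  have hmeas : Measurable fun y => ind y j := measurable_of_countable _
  have h := strong_law_ae_real (μ := P) (fun i ω => ind (X i ω) j)
    ((memLp_ind (hlaw 0).aemeasurable 1 j).integrable le_rfl)
    (fun i i' hii => (hindep.indepFun hii).comp hmeas hmeas)
    fun i => ((hlaw i).identDistrib (hlaw 0)).comp hmeas
  filter_upwards [h] with ω hω
  rw [integral_ind (hlaw 0)] at hω
  refine hω.congr fun n => ?_
  rw [empMass, Finset.sum_range, div_eq_inv_mul]

lemma ae_mem_Icc {m M : ℕ} (hm : IsLeast p.support m) (hM : IsGreatest p.support M)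
    {Y : Ω → ℕ} (hY : HasLaw Y p.toMeasure P) : ∀ᵐ ω ∂P, Y ω ∈ Set.Icc m M := by
  have h : ∀ᵐ y ∂p.toMeasure, y ∈ p.support := by
    rw [ae_iff]
    exact (p.toMeasure_apply_eq_zero_iff MeasurableSet.of_discrete).2
      (Set.disjoint_left.2 fun _ h h' => h' h)
  rw [← hY.map_eq] at h
  filter_upwards [ae_of_ae_map hY.aemeasurable h] with ω hω
  exact ⟨hm.2 hω, hM.2 hω⟩

lemma mass_pos {j : ℕ} (hj : j ∈ p.support) : 0 < mass p j :=
  ENNReal.toReal_pos ((p.mem_support_iff j).1 hj) (p.apply_ne_top j)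

end Sample

/-! ### Measurability and joint asymptotic normality. -/

section Sample

variable {Ω : Type*} [MeasurableSpace Ω] {P : Measure Ω} {p : PMF ℕ}
  {X : ℕ → Ω → ℕ}

/-- The sample space `Fin n → ℕ` is countable, so every function on it is measurable. -/
lemma aemeasurable_rhoHat (hX : ∀ i, AEMeasurable (X i) P) (k n : ℕ) :
    AEMeasurable (fun ω => rhoHat k fun i : Fin n => X i ω) P :=
  (measurable_of_countable (rhoHat k (n := n))).comp_aemeasurable
    (aemeasurable_pi_lambda _ fun i => hX i)

/-- The joint central limit theorem for the `k`-th differences of the empirical mass function. -/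
lemma tendstoInDistribution_nabla_empMass [IsProbabilityMeasure P]
    {Ω' : Type*} [MeasurableSpace Ω'] {P' : Measure Ω'} [IsProbabilityMeasure P'] {k m M : ℕ}
    (hlaw : ∀ i, HasLaw (X i) p.toMeasure P) (hindep : iIndepFun X P)
    {Z : Ω' → EuclideanSpace ℝ (shrink k m M)}
    (hZ : HasLaw Z (multivariateGaussian 0 (covMat P (X 0) k m M)) P') :
    TendstoInDistribution
      (fun (n : ℕ) ω => WithLp.toLp 2 fun j : shrink k m M => √(n : ℝ) *
        (nabla k (empMass fun i : Fin n => X i ω) j - nabla k (mass p) j))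
      atTop Z (fun _ => P) P' := by
  let g : ℕ → EuclideanSpace ℝ (shrink k m M) := fun x =>
    WithLp.toLp 2 fun j => nabla k (ind x) j
  have hg : Measurable g := measurable_of_countable _
  have h := tendstoInDistribution_multivariate (P := P) (Y := fun n ω => g (X n ω)) (Z := Z)
    (fun i => memLp_nabla_ind (hlaw 0).aemeasurable 2 k i) (hindep.comp (fun _ => g) fun _ => hg)
    (fun n => ((hlaw n).identDistrib (hlaw 0)).comp hg) hZ
  refine h.congr (fun n => ae_of_all _ fun ω => ?_) .rfl
  dsimp only [g]
  congr 1
  ext j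
  rw [integral_nabla_ind (hlaw 0), nabla_empMass, Finset.sum_range]
  rcases n.eq_zero_or_pos with rfl | hn
  · simp
  · have hn' : (0 : ℝ) < n := by exact_mod_cast hn
    have hs : (0 : ℝ) < √(n : ℝ) := Real.sqrt_pos.2 hn'
    have hsq : √(n : ℝ) * √(n : ℝ) = n := Real.mul_self_sqrt hn'.le
    field_simp
    rw [pow_two, hsq]

end Sample

end KMono

theorem mainTheorem1
    {Ω : Type*} [MeasurableSpace Ω] (P : Measure Ω) [IsProbabilityMeasure P]
    {Ω' : Type*} [MeasurableSpace Ω'] (P' : Measure Ω') [IsProbabilityMeasure P']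
    (k m M : ℕ) (hk : 1 ≤ k) (hmM : m + k ≤ M)
    (p : PMF ℕ) (hm : IsLeast p.support m) (hM : IsGreatest p.support M)
    -- an i.i.d. sample from `p`; the first `n` observations are `X 0, …, X (n - 1)`
    (X : ℕ → Ω → ℕ) (hlaw : ∀ i, HasLaw (X i) p.toMeasure P) (hindep : iIndepFun X P)
    -- `(Z j)`, for `j` in `{m, …, M - k}`, is a centred Gaussian vector with covariance `Σ`
    (Z : ℕ → Ω' → ℝ)
    (hZ : HasLaw (fun ω => WithLp.toLp 2 fun j : KMono.shrink k m M => Z j ω)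
      (multivariateGaussian 0 (KMono.covMat P (X 0) k m M)) P') :
    (KMono.covMat P (X 0) k m M).PosSemidef ∧
    (KMono.argminSet p k m M).Nonempty ∧
    TendstoInDistribution
      (fun (n : ℕ) ω =>
        √(n : ℝ) * (KMono.rhoHat k (fun i : Fin n => X i ω) - KMono.rho p k m M))
      atTop
      (fun ω => KMono.minOver (KMono.argminSet p k m M) (fun j => Z j ω))
      (fun _ => P) P' ∧
    (KMono.rho p k m M = 0 →
      KMono.argminSet p k m M = KMono.shrink k m M \ KMono.knots p k m M) := by
  open KMono in
  have hX := fun i => (hlaw i).aemeasurable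
  have hI := argminSet_nonempty p hmM
  refine ⟨posSemidef_covMatrix fun j => memLp_nabla_ind (hX 0) 2 k j, hI, ?_,
    argminSet_eq_sdiff_knots p⟩
  -- The value `0` is never read, because `argminSet` lies in `shrink`.
  let g : EuclideanSpace ℝ (shrink k m M) → ℝ := fun v =>
    minOver (argminSet p k m M) fun j => if hj : j ∈ shrink k m M then v ⟨j, hj⟩ else 0
  have hg : Continuous g := continuous_minOver _ fun j hj => by
    simp only [argminSet_subset p k m M hj, dite_true]
    fun_prop
  have hg_apply (f : ℕ → ℝ) : g (WithLp.toLp 2 fun j => f j) = minOver (argminSet p k m M) f :=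
    minOver_congr fun j hj => by simp [argminSet_subset p k m M hj]
  have hmin := (tendstoInDistribution_nabla_empMass hlaw hindep hZ).continuous_comp hg
  have hmin' := hmin.congr (fun n => .rfl) (ae_of_all P' fun ω => hg_apply fun j => Z j ω)
  -- Slutsky: it remains to see that the difference from the minimum over `argminSet` tends to zero
  -- in measure; almost surely it is eventually zero.
  refine tendstoInDistribution_of_tendstoInMeasure_sub _ _ hmin' ?_ fun n =>
    ((aemeasurable_rhoHat hX k n).sub_const _).const_mul _
  refine tendstoInMeasure_of_tendsto_ae ?_ ?_
  · exact fun n => (((aemeasurable_rhoHat hX k n).sub_const _).const_mul _).sub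
      (hmin.forall_aemeasurable n) |>.aestronglyMeasurable
  filter_upwards [ae_tendsto_empMass hlaw hindep,
    ae_all_iff.2 fun i => ae_mem_Icc hm hM (hlaw i)] with ω hω hω'
  refine tendsto_const_nhds.congr' ?_
  filter_upwards [eventually_rhoHat_eq p hmM (mass_pos hm.1) (mass_pos hM.1) hω' hω] with n hn
  have hgn := hg_apply fun j => √(n : ℝ) *
    (nabla k (empMass fun i : Fin n => X i ω) j - nabla k (mass p) j)
  simp only [Pi.sub_apply, Function.comp_apply, Pi.zero_apply]
  rw [hgn, hn, mul_minOver_sub hI (Real.sqrt_nonneg _), eq_comm, sub_eq_zero]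
  exact minOver_congr fun j hj => by rw [((mem_argminSet p k m M).1 hj).2]
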